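/- Let $n, k$ be natural numbers with $0 \le k < n-1$, and let $\vec\kappa = \langle \kappa_0 \le \kappa_1 \le \dots \le \kappa_n\rangle$ be a weakly increasing tuple of infinite cardinals. Let $X(\vec\kappa) = \prod_{i\le n} \alpha(\kappa_i)$, where $\alpha(\kappa_i) = \kappa_i \sqcup \{\infty\}$ is the one-point compactification of the discrete space of size $\kappa_i$, and let $X(\vec\kappa)^-$ be the subspace obtained by removing the point $(\infty,\dots,\infty)$. For $A \subseteq \{0,\dots,n\}$ put $$\mathcal D_A = \{\vec x \in X(\vec\kappa) : x_i \ne \infty \text{ for all } i \in A\}, \qquad F_A = \{\vec x \in X(\vec\kappa) : x_i \neq \infty \text{ if and only if } i \in A\}.$$ For $\vec x \in F_A$ and finite sets $\mathcal E_j \subseteq \kappa_j$ ($j \notin A$), put $$\mathcal N_A(\vec x, \vec{\mathcal E}) = \{\vec y \in X(\vec\kappa) : y_i = x_i \text{ for all } i \in A, \text{ and } y_j = \infty \text{ or } y_j \notin \mathcal E_j \text{ for all } j \notin A\}.$$ A $k$-Fubini partition of $X(\vec\kappa)^-$ is a partition $\langle Y_i : i \le n\rangle$ of $X(\vec\kappa)^-$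 into $n+1$ pairwise disjoint, possibly empty, sets such that for every $A \subseteq \{0,\dots,n\}$ with $|A| \ge k+1$: 1. for every $i \le n$ with $i \notin A$, the set $Y_i \cap \mathcal D_A$ is clopen in $\mathcal D_A$; and 2. for every $\vec x \in F_A$ there are finite sets $\mathcal E_j \subseteq \kappa_j$ ($j \notin A$) such that $\mathcal N_A(\vec x, \vec{\mathcal E}) \subseteq \bigcup_{i \in A} Y_i$. Then a $k$-Fubini partition of $X(\vec\kappa)^-$ exists if and only if $\kappa_{n-k} = \aleph_0$; and $\kappa_{n-k} = \aleph_0$ holds if and only if the first $n-k+1$ entries $\kappa_0, \dots, \kappa_{n-k}$ are all $\aleph_0$. -/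

import Mathlib

universe u

namespace CardTuple

/-- A set of cardinality `c`, carried as a type of its own so that it can be given the discrete
topology. -/
def Disc (c : Cardinal.{u}) : Type u := Quotient.out c

instance (c : Cardinal.{u}) : TopologicalSpace (Disc c) := ⊥

instance (c : Cardinal.{u}) : DiscreteTopology (Disc c) := ⟨rfl⟩

theorem mk_disc (c : Cardinal.{u}) : Cardinal.mk (Disc c) = c := Cardinal.mk_out c

/-- `X(κ) = ∏_{i ≤ n} α(κ_i)`, the product (with the product topology) of the one-point
compactifications of the discrete spaces of size `κ_i`. -/
abbrev X {n : ℕ} (κ : Fin (n + 1) → Cardinal.{u}) : Type u :=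
  (i : Fin (n + 1)) → OnePoint (Disc (κ i))

variable {n : ℕ} (κ : Fin (n + 1) → Cardinal.{u})

/-- `X(κ)⁻`: the space `X(κ)` without the point `(∞, …, ∞)`. -/
def XMinus : Set (X κ) := {x | x ≠ fun _ => OnePoint.infty}

/-- `𝒟_A = {x : x_i ≠ ∞ for all i ∈ A}`. -/
def DSet (A : Finset (Fin (n + 1))) : Set (X κ) :=
  {x | ∀ i ∈ A, x i ≠ OnePoint.infty}

/-- The `A`-facet `F_A = {x : x_i ≠ ∞ if and only if i ∈ A}`. -/
def facet (A : Finset (Fin (n + 1))) : Set (X κ) :=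
  {x | ∀ i, x i ≠ OnePoint.infty ↔ i ∈ A}

variable {κ}

/-- The basic open set `𝒩_A(x, E)`: the points that agree with `x` on the coordinates in `A` and
whose other coordinates `y_j` are `∞` or lie outside the finite set `E_j`. The sets `E_j` with
`j ∈ A` play no role. -/
def basicNhd (A : Finset (Fin (n + 1))) (x : X κ) (E : (j : Fin (n + 1)) → Finset (Disc (κ j))) :
    Set (X κ) :=
  {y | (∀ i ∈ A, y i = x i) ∧
    ∀ j, j ∉ A → y j = OnePoint.infty ∨ ∃ d : Disc (κ j), y j = (d : OnePoint (Disc (κ j))) ∧ d ∉ E j}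

variable (κ)

/-- `⟨Y_i : i ≤ n⟩` is a `k`-Fubini partition of `X(κ)⁻` (pieces may be empty). -/
structure IsFubiniPartition (k : ℕ) (Y : Fin (n + 1) → Set (X κ)) : Prop where
  iUnion_eq : ⋃ i, Y i = XMinus κ
  pairwise_disjoint : ∀ i j, i ≠ j → Disjoint (Y i) (Y j)
  /-- For `|A| ≥ k + 1` and `i ∉ A`, the set `Y_i` (that is, its trace) is clopen in `𝒟_A`. -/
  isClopen : ∀ A : Finset (Fin (n + 1)), k + 1 ≤ A.card → ∀ i, i ∉ A →
    IsClopen {x : DSet κ A | (x : X κ) ∈ Y i}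
  /-- For `|A| ≥ k + 1`, every point of `F_A` has a basic neighbourhood inside `⋃_{i ∈ A} Y_i`. -/
  exists_basicNhd : ∀ A : Finset (Fin (n + 1)), k + 1 ≤ A.card → ∀ x ∈ facet κ A,
    ∃ E : (j : Fin (n + 1)) → Finset (Disc (κ j)), basicNhd A x E ⊆ ⋃ i ∈ A, Y i

end CardTuple

/-!
If at most `k` of the cardinals are uncountable, rank all the elements of the countable factors
injectively by natural numbers, give `∞` the rank `⊤`, and let `Y i` consist of the points whose
entry of least rank is the `i`-th one. Ranks are continuous, so these sets are open, and they cover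
every point with more than `k` finite coordinates. The remaining points can be put into any piece.

Conversely, suppose that the set `U` of coordinates with uncountable factors has more than `k`
elements, and colour a point `x` by the index `c x` of its piece. If the set `B` of finite
coordinates of `x` has at least `k + 2` elements, then `e = c x` is in `B`, and `Y e` is a
neighbourhood of `x` because its trace on `𝒟_{B \ {e}}` is clopen. Applied to points whose only
infinite entry is the `i`-th one, this shows that on a line in direction `i` all but finitely many
points have the same colour, and this colour is not `i`. Fix a countable infinite set `N i` in each
factor, and choose `w i`, by recursion on `i ∈ U`, outside the exceptional sets of the countably
many lines in direction `i` through points whose entries lie in `N` or among `w 0, …, w (i - 1)`.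

Near the point of `F_U` with entries `w` there is one, `x`, whose remaining entries are in `N` and
whose colour `i` is in `U`. The entries `w m` of `x` with `m > i` can be replaced by elements of
`N m`, largest `m` first, without changing the colour. The point so obtained is on one of the lines
considered in the choice of `w i`, hence its colour is not `i`.
-/

open Filter Function Set Topology
open scoped Finset OnePoint

namespace CardTuple

section Generic

variable {ι : Type*} {D : ι → Type*}

theorem exists_forall_rel_restrict [LT ι] [WellFoundedLT ι]
    {R : ∀ i, (∀ j, j < i → D j) → D i → Prop} (hR : ∀ i f, ∃ t, R i f t) :
    ∃ w : ∀ i, D i, ∀ i, R i (fun j _ => w j) (w i) := by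
  choose g hg using hR
  refine ⟨wellFounded_lt.fix g, fun i => ?_⟩
  rw [WellFounded.fix_eq]
  exact hg i _

/-- The points whose `l`-th coordinate is in `N l` or, for `l < i`, equal to `f l`. In the
choice of the coordinates of a generic point, `f` lists those chosen before the `i`-th one. -/
def prefixGrid [LT ι] (N : ∀ l, Set (D l)) (i : ι) (f : ∀ l, l < i → D l) : Set (∀ l, D l) :=
  {x | ∀ l, x l ∈ N l ∨ ∃ h : l < i, x l = f l h}

theorem countable_prefixGrid [LT ι] [Finite ι] {N : ∀ l, Set (D l)} (hN : ∀ l, (N l).Countable)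
    (i : ι) (f : ∀ l, l < i → D l) : (prefixGrid N i f).Countable := by
  have hf : ∀ l, {t | ∃ h : l < i, t = f l h}.Subsingleton := by
    rintro l _ ⟨_, rfl⟩ _ ⟨_, rfl⟩
    rfl
  have hpi : prefixGrid N i f ⊆ univ.pi fun l => N l ∪ {t | ∃ h : l < i, t = f l h} :=
    fun x hx l _ => hx l
  exact (countable_univ_pi fun l => (hN l).union (hf l).countable).mono hpi

/-- The points whose `l`-th coordinate is in `N l` or, for uncountable `D l`, equal to `w l`.
Colours are compared on this grid, where entries `w l` are traded for entries in `N l`. -/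
def genericGrid (N : ∀ l, Set (D l)) (w : ∀ l, D l) : Set (∀ l, D l) :=
  {x | ∀ l, x l ∈ N l ∨ Uncountable (D l) ∧ x l = w l}

section Stable

variable {γ : Type*} [DecidableEq ι] {c : (∀ l, D l) → γ} {i : ι} {x : ∀ l, D l}

/-- The colour of `x` is shared by all but finitely many points of the line through `x` in
direction `i`. -/
def IsStable (c : (∀ l, D l) → γ) (i : ι) (x : ∀ l, D l) : Prop :=
  ∀ᶠ t in cofinite, c (update x i t) = c x

/-- The coordinate `w i` of a generic point `w`, for uncountable `D i`, gives a stable colour in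
direction `i` when the other coordinates are in `N` or earlier coordinates of `w`. -/
def IsGeneric [LT ι] (c : (∀ l, D l) → γ) (N : ∀ l, Set (D l)) (w : ∀ l, D l) : Prop :=
  ∀ i, Uncountable (D i) → ∀ x ∈ prefixGrid N i fun l _ => w l, IsStable c i (update x i (w i))

theorem finite_setOf_not_isStable {e : γ} (he : ∀ᶠ t in cofinite, c (update x i t) = e) :
    {t | ¬ IsStable c i (update x i t)}.Finite := by
  refine Finite.subset he fun t ht (hte : c (update x i t) = e) => ht ?_
  simpa only [IsStable, update_idem, hte] using he

theorem IsStable.ne [Infinite (D i)] {a : γ} (hx : IsStable c i x)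
    (ha : ∃ e ≠ a, ∀ᶠ t in cofinite, c (update x i t) = e) : c x ≠ a := by
  obtain ⟨e, hea, he⟩ := ha
  obtain ⟨t, htx, hte⟩ := (hx.and he).exists
  rwa [← htx, hte]

theorem IsStable.exists_mem (hx : IsStable c i x) {s : Set (D i)} (hs : s.Infinite) :
    ∃ t ∈ s, c (update x i t) = c x :=
  ((frequently_cofinite_mem_iff_infinite.2 hs).and_eventually hx).exists

theorem exists_isGeneric [LT ι] [WellFoundedLT ι] [Finite ι] [∀ i, Nonempty (D i)]
    (hc : ∀ i x, ∃ e, ∀ᶠ t in cofinite, c (update x i t) = e)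
    {N : ∀ l, Set (D l)} (hN : ∀ l, (N l).Countable) : ∃ w, IsGeneric c N w := by
  refine exists_forall_rel_restrict (R := fun i f t => Uncountable (D i) →
    ∀ x ∈ prefixGrid N i f, IsStable c i (update x i t)) fun i f => ?_
  by_cases hi : Uncountable (D i)
  · have hbad : (⋃ x ∈ prefixGrid N i f, {t | ¬ IsStable c i (update x i t)}).Countable :=
      (countable_prefixGrid hN i f).biUnion fun x _ =>
        (finite_setOf_not_isStable (hc i x).choose_spec).countable
    obtain ⟨t, ht⟩ := (ne_univ_iff_exists_notMem _).1 fun h =>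
      not_countable_univ (hbad.mono h.ge)
    exact ⟨t, fun _ x hx => by_contra fun h => ht (mem_biUnion hx h)⟩
  · exact ⟨Classical.arbitrary _, fun h => absurd h hi⟩

end Stable

section LinearOrder

variable {γ : Type*} [LinearOrder ι] {c : (∀ l, D l) → γ} {N : ∀ l, Set (D l)} {w x : ∀ l, D l}

theorem update_mem_genericGrid (hx : x ∈ genericGrid N w) {i : ι} {t : D i} (ht : t ∈ N i) :
    update x i t ∈ genericGrid N w := by
  intro l
  rcases eq_or_ne l i with rfl | hl
  · exact Or.inl (by rwa [update_self])
  · simpa only [update_of_ne hl] using hx l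

theorem IsGeneric.isStable (hw : IsGeneric c N w) (hne : ∀ l, (N l).Nonempty)
    (hx : x ∈ genericGrid N w) {i : ι} (hi : Uncountable (D i)) (hxw : x i = w i)
    (hgt : ∀ l, i < l → x l ∈ N l) : IsStable c i x := by
  obtain ⟨t, ht⟩ := hne i
  suffices hgrid : update x i t ∈ prefixGrid N i fun l _ => w l by
    simpa only [update_idem, ← hxw, update_eq_self] using hw i hi _ hgrid
  intro l
  rcases lt_trichotomy l i with hl | rfl | hl
  · simpa only [update_of_ne hl.ne, hl, exists_true_left] using (hx l).imp_right And.right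
  · exact Or.inl (by rwa [update_self])
  · exact Or.inl (by rw [update_of_ne hl.ne']; exact hgt l hl)

theorem IsGeneric.exists_mem_color_update_eq (hw : IsGeneric c N w) (hN : ∀ l, (N l).Infinite)
    (hx : x ∈ genericGrid N w) {m : ι} (hgt : ∀ l, m < l → x l ∈ N l) :
    ∃ t ∈ N m, c (update x m t) = c x := by
  rcases hx m with hm | ⟨hm, hxw⟩
  · exact ⟨x m, hm, by rw [update_eq_self]⟩
  · exact (hw.isStable (fun l => (hN l).nonempty) hx hm hxw hgt).exists_mem (hN m)

theorem IsGeneric.exists_forall_gt_mem [Finite ι] (hw : IsGeneric c N w)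
    (hN : ∀ l, (N l).Infinite) (i : ι) (hx : x ∈ genericGrid N w) :
    ∃ y ∈ genericGrid N w, (∀ l, i < l → y l ∈ N l) ∧ y i = x i ∧ c y = c x := by
  cases nonempty_fintype ι
  suffices h : ∀ (s : Finset ι), ∀ x ∈ genericGrid N w, (∀ l, i < l → l ∉ s → x l ∈ N l) →
      ∃ y ∈ genericGrid N w, (∀ l, i < l → y l ∈ N l) ∧ y i = x i ∧ c y = c x from
    h Finset.univ x hx fun l _ hl => absurd (Finset.mem_univ l) hl
  intro s
  induction s using Finset.induction_on_max with
  | empty => exact fun x hx hs => ⟨x, hx, fun l hl => hs l hl (Finset.notMem_empty l), rfl, rfl⟩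
  | insert m s hms ih =>
    intro x hx hs
    have hs' : ∀ l, i < l → l ≠ m → l ∉ s → x l ∈ N l := fun l hl hlm hls =>
      hs l hl (by simp [hlm, hls])
    rcases lt_or_ge i m with him | hmi
    · obtain ⟨t, htN, htc⟩ := hw.exists_mem_color_update_eq hN hx fun l hl =>
        hs' l (him.trans hl) hl.ne' fun hls => hl.not_gt (hms l hls)
      obtain ⟨y, hy, hgt, hyi, hyc⟩ := ih (update x m t) (update_mem_genericGrid hx htN) <| by
        intro l hl hls
        rcases eq_or_ne l m with rfl | hlm
        · rwa [update_self]
        · simpa only [update_of_ne hlm] using hs' l hl hlm hls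
      exact ⟨y, hy, hgt, hyi.trans (update_of_ne him.ne _ _), hyc.trans htc⟩
    · exact ih x hx fun l hl => hs' l hl (hmi.trans_lt hl).ne'

theorem exists_forall_apply_color_ne [Finite ι] [∀ i, Infinite (D i)] {c : (∀ l, D l) → ι}
    (hc : ∀ i x, ∃ e ≠ i, ∀ᶠ t in cofinite, c (update x i t) = e)
    (hinf : ∀ l, (N l).Infinite) (hN : ∀ l, (N l).Countable) :
    ∃ w, ∀ x ∈ genericGrid N w, Uncountable (D (c x)) → x (c x) ≠ w (c x) := by
  obtain ⟨w, hw⟩ := exists_isGeneric (fun i x => (hc i x).imp fun _ => And.right) hN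
  refine ⟨w, fun x hx hU hxw => ?_⟩
  obtain ⟨y, hy, hgt, hyx, hcy⟩ := hw.exists_forall_gt_mem hinf (c x) hx
  have hstable : IsStable c (c x) y :=
    hw.isStable (fun l => (hinf l).nonempty) hy hU (hyx.trans hxw) hgt
  exact hstable.ne (hc _ y) hcy

end LinearOrder

end Generic

section Topology

theorem isClopen_of_pairwise_disjoint_of_iUnion_eq_univ {ι α : Type*} [TopologicalSpace α]
    {s : ι → Set α} (ho : ∀ i, IsOpen (s i)) (hd : Pairwise (Disjoint on s))
    (hs : ⋃ i, s i = univ) (i : ι) : IsClopen (s i) := by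
  have hcompl : (s i)ᶜ = ⋃ j ≠ i, s j := by
    ext x
    simp only [mem_compl_iff, mem_iUnion, exists_prop]
    refine ⟨fun hx => ?_, fun ⟨j, hji, hj⟩ hi => disjoint_left.1 (hd hji) hj hi⟩
    obtain ⟨j, hj⟩ := mem_iUnion.1 (hs.symm ▸ mem_univ x)
    exact ⟨j, fun h => hx (h ▸ hj), hj⟩
  exact ⟨⟨hcompl ▸ isOpen_biUnion fun j _ => ho j⟩, ho i⟩

theorem continuous_elim_top_natCast {α : Type*} [TopologicalSpace α] [DiscreteTopology α]
    {f : α → ℕ} (hf : Injective f) :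
    Continuous fun t : OnePoint α => t.elim (⊤ : ℕ∞) fun a => (f a : ℕ∞) := by
  rw [OnePoint.continuous_iff_from_discrete]
  exact ENat.tendsto_natCast_nhds_top.comp (Nat.cofinite_eq_atTop ▸ hf.tendsto_cofinite)

theorem exists_continuous_rank {ι : Type*} [Countable ι] (D : ι → Type*)
    [∀ i, TopologicalSpace (D i)] [∀ i, DiscreteTopology (D i)] :
    ∃ ρ : ∀ i, OnePoint (D i) → ℕ∞, (∀ i, Continuous (ρ i)) ∧ (∀ i, ρ i ∞ = ⊤) ∧
      (∀ i, Countable (D i) → ∀ t ≠ ∞, ρ i t ≠ ⊤) ∧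
      ∀ i j s t, ρ i s ≠ ⊤ → ρ i s = ρ j t → i = j := by
  classical
  have (i : {i // Countable (D i)}) : Countable (D i) := i.2
  obtain ⟨f, hf⟩ := exists_injective_nat (Σ i : {i // Countable (D i)}, D i)
  let ρ (i : ι) (t : OnePoint (D i)) : ℕ∞ :=
    if h : Countable (D i) then t.elim ⊤ fun d => (f ⟨⟨i, h⟩, d⟩ : ℕ∞) else ⊤
  refine ⟨ρ, fun i => ?_, fun i => ?_, fun i hi t ht => ?_, fun i j s t hs hst => ?_⟩
  · by_cases h : Countable (D i)
    · simpa only [ρ, dif_pos h, comp_apply] using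
      continuous_elim_top_natCast (hf.comp (sigma_mk_injective (i := ⟨i, h⟩)))
    · simpa only [ρ, dif_neg h] using continuous_const
  · simp [ρ]
  · obtain ⟨d, rfl⟩ := OnePoint.ne_infty_iff_exists.1 ht
    simp [ρ, hi]
  · have hfinite : ∀ i t, ρ i t ≠ ⊤ → ∃ h : Countable (D i), ∃ d, ρ i t = f ⟨⟨i, h⟩, d⟩ := by
      intro i t ht
      by_cases h : Countable (D i)
      · induction t using OnePoint.rec with
        | infty => simp [ρ] at ht
        | coe d => exact ⟨h, d, by simp [ρ, h]⟩
      · simp [ρ, h] at ht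
    obtain ⟨hi, d, hd⟩ := hfinite i s hs
    obtain ⟨hj, d', hd'⟩ := hfinite j t (hst ▸ hs)
    exact congrArg (fun p => p.1.1) (hf (Nat.cast_injective (hd.symm.trans (hst.trans hd'))))

end Topology

variable {n k : ℕ} {κ : Fin (n + 1) → Cardinal.{u}}

theorem uncountable_disc_iff {c : Cardinal.{u}} : Uncountable (Disc c) ↔ Cardinal.aleph0 < c := by
  rw [← Cardinal.aleph0_lt_mk_iff, mk_disc]

theorem infinite_disc_iff {c : Cardinal.{u}} : Infinite (Disc c) ↔ Cardinal.aleph0 ≤ c := by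
  rw [Cardinal.infinite_iff, mk_disc]

theorem isOpen_dSet (A : Finset (Fin (n + 1))) : IsOpen (DSet κ A) := by
  simp only [DSet, ofPred_forall]
  exact isOpen_biInter_finset fun i _ => isOpen_ne.preimage (continuous_apply i)

theorem facet_subset_dSet (A : Finset (Fin (n + 1))) : facet κ A ⊆ DSet κ A :=
  fun _ hx i hi => (hx i).2 hi

theorem eq_infty_of_mem_facet {A : Finset (Fin (n + 1))} {x : X κ} (hx : x ∈ facet κ A)
    {i : Fin (n + 1)} (hi : i ∉ A) : x i = ∞ :=
  by_contra fun h => hi ((hx i).1 h)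

theorem mem_basicNhd_self {A : Finset (Fin (n + 1))} {x : X κ} (hx : x ∈ facet κ A)
    (E : ∀ j, Finset (Disc (κ j))) : x ∈ basicNhd A x E :=
  ⟨fun _ _ => rfl, fun _ hj => Or.inl (eq_infty_of_mem_facet hx hj)⟩

theorem exists_basicNhd_subset {A : Finset (Fin (n + 1))} {x : X κ} (hx : x ∈ facet κ A)
    {V : Set (X κ)} (hV : IsOpen V) (hxV : x ∈ V) : ∃ E, basicNhd A x E ⊆ V := by
  obtain ⟨u, hu, huV⟩ := isOpen_pi_iff'.1 hV x hxV
  have hfin : ∀ j, j ∉ A → {d : Disc (κ j) | (d : OnePoint (Disc (κ j))) ∉ u j}.Finite := by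
    intro j hj
    have hmem : ∞ ∈ u j := eq_infty_of_mem_facet hx hj ▸ (hu j).2
    exact isCompact_iff_finite.1 ((OnePoint.isOpen_def.1 (hu j).1).1 hmem)
  classical
  refine ⟨fun j => if hj : j ∈ A then ∅ else (hfin j hj).toFinset, fun y hy => huV fun j _ => ?_⟩
  by_cases hj : j ∈ A
  · exact hy.1 j hj ▸ (hu j).2
  · rcases hy.2 j hj with hyj | ⟨d, hyj, hd⟩
    · rw [hyj, ← eq_infty_of_mem_facet hx hj]
      exact (hu j).2
    · rw [hyj]
      simpa [hj] using hd

/-- The point of `X κ` with the finite coordinates `a i`. -/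
def ofDisc (a : ∀ i, Disc (κ i)) : X κ := fun i => a i

theorem ofDisc_update (a : ∀ i, Disc (κ i)) (i : Fin (n + 1)) (t : Disc (κ i)) :
    ofDisc (update a i t) = update (ofDisc a) i (t : OnePoint (Disc (κ i))) :=
  funext fun l => apply_update (fun l => ((↑) : Disc (κ l) → OnePoint (Disc (κ l)))) a i t l

/-- The points whose entry of least rank, for the rank functions `ρ`, is their `i`-th entry. The
rank `⊤` does not count, so a point all of whose entries have rank `⊤` is in none of these sets. -/
def leastRankSet (ρ : ∀ i, OnePoint (Disc (κ i)) → ℕ∞) (i : Fin (n + 1)) : Set (X κ) :=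
  {x | ρ i (x i) < ⊤ ∧ ∀ j ≠ i, ρ i (x i) < ρ j (x j)}

theorem isOpen_leastRankSet {ρ : ∀ i, OnePoint (Disc (κ i)) → ℕ∞} (hρ : ∀ i, Continuous (ρ i))
    (i : Fin (n + 1)) : IsOpen (leastRankSet ρ i) := by
  have hcont : ∀ j, Continuous fun x : X κ => ρ j (x j) := fun j => (hρ j).comp (continuous_apply j)
  simp only [leastRankSet, ofPred_and, ofPred_forall]
  exact (isOpen_lt (hcont i) continuous_const).inter
    (isOpen_iInter_of_finite fun j => isOpen_iInter_of_finite fun _ =>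
      isOpen_lt (hcont i) (hcont j))

theorem pairwise_disjoint_leastRankSet (ρ : ∀ i, OnePoint (Disc (κ i)) → ℕ∞) :
    Pairwise (Disjoint on leastRankSet ρ) := fun i j hij =>
  disjoint_left.2 fun _ hi hj => (hi.2 j hij.symm).not_gt (hj.2 i hij)

theorem exists_mem_leastRankSet {ρ : ∀ i, OnePoint (Disc (κ i)) → ℕ∞}
    (hρ : ∀ i j s t, ρ i s ≠ ⊤ → ρ i s = ρ j t → i = j) {x : X κ}
    (hx : ∃ i, ρ i (x i) ≠ ⊤) : ∃ i, x ∈ leastRankSet ρ i := by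
  obtain ⟨i₀, hi₀⟩ := hx
  obtain ⟨i, hi⟩ := Finite.exists_min fun i => ρ i (x i)
  have htop : ρ i (x i) < ⊤ := (hi i₀).trans_lt hi₀.lt_top
  exact ⟨i, htop, fun j hji => (hi j).lt_of_ne fun h => hji (hρ i j _ _ htop.ne h).symm⟩

theorem exists_isFubiniPartition_of_isOpen {Z : Fin (n + 1) → Set (X κ)}
    (hopen : ∀ i, IsOpen (Z i)) (hdisj : Pairwise (Disjoint on Z))
    (hfinite : ∀ i, ∀ x ∈ Z i, x i ≠ ∞)
    (hcover : ∀ A : Finset (Fin (n + 1)), k + 1 ≤ #A → DSet κ A ⊆ ⋃ i, Z i) :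
    ∃ Y, IsFubiniPartition κ k Y := by
  have hZ : ∀ i, Z i ⊆ XMinus κ := fun i x hx h => hfinite i x hx (congrFun h i)
  let Y (i : Fin (n + 1)) : Set (X κ) := Z i ∪ {x | i = 0 ∧ x ∈ XMinus κ \ ⋃ j, Z j}
  refine ⟨Y, ?_, fun i j hij => ?_, fun A hA i _ => ?_, fun A hA x hx => ?_⟩
  · refine (iUnion_subset fun i => union_subset (hZ i) fun x hx => hx.2.1).antisymm fun x hx => ?_
    by_cases h : x ∈ ⋃ j, Z j
    · exact iUnion_mono (fun _ => subset_union_left) h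
    · exact mem_iUnion.2 ⟨0, Or.inr ⟨rfl, hx, h⟩⟩
  · refine disjoint_left.2 ?_
    rintro x (hi | ⟨rfl, hi⟩) (hj | ⟨rfl, hj⟩)
    · exact disjoint_left.1 (hdisj hij) hi hj
    · exact hj.2 (mem_iUnion_of_mem i hi)
    · exact hi.2 (mem_iUnion_of_mem j hj)
    · exact hij rfl
  · have htrace : {x : DSet κ A | (x : X κ) ∈ Y i} = (↑) ⁻¹' Z i := by
      ext x
      exact or_iff_left fun h => h.2.2 (hcover A hA x.2)
    rw [htrace]
    refine isClopen_of_pairwise_disjoint_of_iUnion_eq_univ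
      (s := fun j => ((↑) ⁻¹' Z j : Set (DSet κ A)))
      (fun j => (hopen j).preimage continuous_subtype_val)
      (fun j l hjl => (hdisj hjl).preimage _) ?_ i
    rw [← preimage_iUnion]
    exact eq_univ_of_forall fun x => hcover A hA x.2
  · obtain ⟨i, hi⟩ := mem_iUnion.1 (hcover A hA (facet_subset_dSet A hx))
    obtain ⟨E, hE⟩ := exists_basicNhd_subset hx (hopen i) hi
    exact ⟨E, fun y hy => mem_biUnion ((hx i).1 (hfinite i x hi)) (Or.inl (hE hy))⟩

theorem exists_isFubiniPartition_of_card_le (h : #{i | Cardinal.aleph0 < κ i} ≤ k) :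
    ∃ Y, IsFubiniPartition κ k Y := by
  obtain ⟨ρ, hcont, hinfty, htop, hinj⟩ := exists_continuous_rank fun i => Disc (κ i)
  refine exists_isFubiniPartition_of_isOpen (isOpen_leastRankSet hcont)
    (pairwise_disjoint_leastRankSet ρ) (fun i x hx hxi => ?_) fun A hA x hx => ?_
  · exact hx.1.ne (by rw [hxi, hinfty])
  · obtain ⟨i, hiA, hi⟩ := Finset.exists_mem_notMem_of_card_lt_card (h.trans_lt hA)
    have hcountable : Countable (Disc (κ i)) := by
      rw [← not_uncountable_iff, uncountable_disc_iff]
      simpa using hi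
    exact mem_iUnion.2 (exists_mem_leastRankSet hinj ⟨i, htop i hcountable _ (hx i hiA)⟩)

namespace IsFubiniPartition

variable {Y : Fin (n + 1) → Set (X κ)}

theorem exists_mem_nhds (hY : IsFubiniPartition κ k Y) {B : Finset (Fin (n + 1))}
    (hB : k + 2 ≤ #B) {x : X κ} (hx : x ∈ facet κ B) : ∃ e ∈ B, Y e ∈ 𝓝 x := by
  obtain ⟨E, hE⟩ := hY.exists_basicNhd B (by lia) x hx
  obtain ⟨e, he, hxe⟩ := mem_iUnion₂.1 (hE (mem_basicNhd_self hx E))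
  have hcard : k + 1 ≤ #(B.erase e) := by rw [Finset.card_erase_of_mem he]; lia
  have hopen := (hY.isClopen _ hcard e (Finset.notMem_erase e B)).isOpen
  have hD : x ∈ DSet κ (B.erase e) := fun i hi => (hx i).2 (Finset.mem_of_mem_erase hi)
  refine ⟨e, he, mem_of_superset
    (((isOpen_dSet _).isOpenMap_subtype_val _ hopen).mem_nhds ⟨⟨x, hD⟩, hxe, rfl⟩) ?_⟩
  rintro _ ⟨y, hy, rfl⟩
  exact hy

theorem exists_ne_eventually_update_mem (hY : IsFubiniPartition κ k Y) {B : Finset (Fin (n + 1))}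
    (hB : k + 2 ≤ #B) {x : X κ} (hx : x ∈ facet κ B) {j : Fin (n + 1)} (hj : j ∉ B) :
    ∃ e ≠ j, ∀ᶠ t : Disc (κ j) in cofinite, update x j (t : OnePoint (Disc (κ j))) ∈ Y e := by
  obtain ⟨e, he, hxe⟩ := hY.exists_mem_nhds hB hx
  have hcont : Continuous fun t : OnePoint (Disc (κ j)) => update x j t :=
    continuous_const.update j continuous_id
  have hlim := (OnePoint.continuous_iff_from_discrete _).1 hcont
  rw [← eq_infty_of_mem_facet hx hj, update_eq_self] at hlim
  exact ⟨e, ne_of_mem_of_not_mem he hj, hlim hxe⟩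

theorem eq_of_mem (hY : IsFubiniPartition κ k Y) {i j : Fin (n + 1)} {x : X κ} (hi : x ∈ Y i)
    (hj : x ∈ Y j) : i = j :=
  by_contra fun h => disjoint_left.1 (hY.pairwise_disjoint i j h) hi hj

theorem exists_color (hY : IsFubiniPartition κ k Y) :
    ∃ c : (∀ i, Disc (κ i)) → Fin (n + 1), ∀ a e, ofDisc a ∈ Y e ↔ c a = e := by
  have hmem : ∀ a : ∀ i, Disc (κ i), ∃ e, ofDisc a ∈ Y e := by
    intro a
    rw [← mem_iUnion, hY.iUnion_eq]
    exact fun h => OnePoint.coe_ne_infty _ (congrFun h 0)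
  choose c hc using hmem
  exact ⟨c, fun a e => ⟨hY.eq_of_mem (hc a), fun h => h ▸ hc a⟩⟩

theorem exists_ne_eventually_color_eq (hY : IsFubiniPartition κ k Y) (hk : k + 1 < n)
    {c : (∀ i, Disc (κ i)) → Fin (n + 1)} (hc : ∀ a e, ofDisc a ∈ Y e ↔ c a = e)
    (i : Fin (n + 1)) (a : ∀ l, Disc (κ l)) :
    ∃ e ≠ i, ∀ᶠ t in cofinite, c (update a i t) = e := by
  have hfacet : update (ofDisc a) i ∞ ∈ facet κ (Finset.univ.erase i) := by
    intro l
    rcases eq_or_ne l i with rfl | hl <;> simp [ofDisc, *]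
  have hcard : k + 2 ≤ (Finset.univ.erase i).card := by
    rw [Finset.card_erase_of_mem (Finset.mem_univ i), Finset.card_fin]
    lia
  obtain ⟨e, hei, he⟩ :=
    hY.exists_ne_eventually_update_mem hcard hfacet (Finset.notMem_erase i _)
  exact ⟨e, hei, by simpa only [update_idem, ← ofDisc_update, hc] using he⟩

theorem card_uncountable_le (hY : IsFubiniPartition κ k Y) (hk : k + 1 < n)
    (hκ : ∀ i, Cardinal.aleph0 ≤ κ i) : #{i | Cardinal.aleph0 < κ i} ≤ k := by
  by_contra! hcard
  set U : Finset (Fin (n + 1)) := {i | Cardinal.aleph0 < κ i} with hUdef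
  have hU : ∀ i, i ∈ U ↔ Uncountable (Disc (κ i)) := fun i => by
    simp [hUdef, uncountable_disc_iff]
  have (i : Fin (n + 1)) : Infinite (Disc (κ i)) := infinite_disc_iff.2 (hκ i)
  let N (i : Fin (n + 1)) : Set (Disc (κ i)) := range (Infinite.natEmbedding (Disc (κ i)))
  have hN : ∀ i, (N i).Infinite := fun i => infinite_range_of_injective (Embedding.injective _)
  obtain ⟨c, hc⟩ := hY.exists_color
  obtain ⟨w, hw⟩ := exists_forall_apply_color_ne (hY.exists_ne_eventually_color_eq hk hc) hN
    fun i => countable_range _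
  let z : X κ := fun i => if i ∈ U then (w i : OnePoint (Disc (κ i))) else ∞
  have hz : z ∈ facet κ U := fun i => by simp [z]
  obtain ⟨E, hE⟩ := hY.exists_basicNhd U hcard z hz
  choose b hbN hbE using fun i => ((hN i).sdiff (E i).finite_toSet).nonempty
  let a (i : Fin (n + 1)) : Disc (κ i) := if i ∈ U then w i else b i
  have ha : ofDisc a ∈ basicNhd U z E :=
    ⟨fun i hi => by simp [ofDisc, a, z, hi],
      fun j hj => Or.inr ⟨b j, by simp [ofDisc, a, hj], hbE j⟩⟩
  obtain ⟨e, heU, he⟩ := mem_iUnion₂.1 (hE ha)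
  obtain rfl := (hc a e).1 he
  refine hw a (fun l => ?_) ((hU _).1 heU) (if_pos heU)
  by_cases hl : l ∈ U
  · exact Or.inr ⟨(hU l).1 hl, if_pos hl⟩
  · exact Or.inl (by simpa only [a, if_neg hl] using hbN l)

end IsFubiniPartition

theorem card_filter_lt_le_iff_of_monotone {α : Type*} [LinearOrder α] {f : Fin (n + 1) → α}
    (hf : Monotone f) {a : α} (hk : k ≤ n) :
    #{i | a < f i} ≤ k ↔ f ⟨n - k, Nat.lt_succ_of_le (Nat.sub_le n k)⟩ ≤ a := by
  set p : Fin (n + 1) := ⟨n - k, Nat.lt_succ_of_le (Nat.sub_le n k)⟩ with hp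
  constructor
  · contrapose!
    intro hlt
    have hsub : Finset.Ici p ⊆ Finset.univ.filter fun i => a < f i := fun i hi =>
      (Finset.mem_filter_univ i).2 (hlt.trans_le (hf (Finset.mem_Ici.1 hi)))
    have hcard := Finset.card_le_card hsub
    rw [Fin.card_Ici, hp] at hcard
    lia
  · intro hle
    have hsub : ({i | a < f i} : Finset (Fin (n + 1))) ⊆ Finset.Ioi p := fun i hi =>
      Finset.mem_Ioi.2 (hf.reflect_lt (hle.trans_lt ((Finset.mem_filter_univ i).1 hi)))
    have hcard := Finset.card_le_card hsub
    rw [Fin.card_Ioi, hp] at hcard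
    lia

end CardTuple

theorem mainTheorem5_general {n k : ℕ} (hk : k + 1 < n) {κ : Fin (n + 1) → Cardinal.{u}}
    (hκ : ∀ i, Cardinal.aleph0 ≤ κ i) :
    (∃ Y : Fin (n + 1) → Set (CardTuple.X κ), CardTuple.IsFubiniPartition κ k Y) ↔
      #{i | Cardinal.aleph0 < κ i} ≤ k :=
  ⟨fun ⟨_, hY⟩ => hY.card_uncountable_le hk hκ, CardTuple.exists_isFubiniPartition_of_card_le⟩

theorem mainTheorem5 (n k : ℕ) (hk : k + 1 < n) (κ : Fin (n + 1) → Cardinal.{u})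
    (hκ : ∀ i, Cardinal.aleph0 ≤ κ i) (hmono : Monotone κ) :
    ((∃ Y : Fin (n + 1) → Set (CardTuple.X κ), CardTuple.IsFubiniPartition κ k Y) ↔
        κ ⟨n - k, Nat.lt_succ_of_le (Nat.sub_le n k)⟩ = Cardinal.aleph0) ∧
      (κ ⟨n - k, Nat.lt_succ_of_le (Nat.sub_le n k)⟩ = Cardinal.aleph0 ↔
        ∀ i : Fin (n + 1), (i : ℕ) < n - k + 1 → κ i = Cardinal.aleph0) := by
  refine ⟨?_, fun h i hi => ((hmono (Nat.lt_succ_iff.1 hi)).trans h.le).antisymm (hκ i),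
    fun h => h _ (Nat.lt_succ_self _)⟩
  rw [mainTheorem5_general hk hκ, CardTuple.card_filter_lt_le_iff_of_monotone hmono (by lia)]
  exact (hκ _).ge_iff_eq'
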